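/- Let $K$ be a number field with algebraic closure $\bar K$. Write $\zeta_m\in\bar K$ for a primitive $m$-th root of unity and $i=\zeta_4$; for a field $L$ put $L^m=\{\beta^m:\beta\in L\}$, and let $\nu_p$ be the $p$-adic valuation on $\mathbb Z$. For an odd prime $p$ let $\epsilon_p$ be the greatest common divisor of the ramification indices $e_{\mathfrak p/p}$ over all primes $\mathfrak p$ of $K$ above $p$, and call $p$ distinguished if $(p-1)\mid\epsilon_p$. Let $\epsilon_2$ be the greatest common divisor of the ramification indices $e_{\mathfrak p/(1+i)}$ over all primes $\mathfrak p$ of $K(i)$ above the prime $1+i$ of $\mathbb Q(i)$. Define $$\lambda_p=\begin{cases}\nu_p(\epsilon_p)+1,& p \text{ odd and distinguished},\\ \nu_2(\epsilon_2)+3,& p=2,\\ 0,&\text{for all other } p.\end{cases}$$ **Proposition.** Let $n$ be a positive integer, $p$ a prime divisor of $n$, $r=\nu_p(n)$ and $\lambda=\lambda_p$. 1. If $p\ge 3$, or if $p=2$ and $i\in K$, then $$K(\zeta_{np^{\lambda}})^{p^{\lambda+r}}\cap K\subset K^{p^r};$$ that is, every $\alpha\in K$ that is a $p^{\lambda+r}$-th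 power in $K(\zeta_{np^\lambda})$ is a $p^r$-th power in $K$. 2. If $p=2$ and $i\notin K$, then $$K(\zeta_{n\cdot 4^{\lambda}})^{2^{2\lambda+r}}\cap K\subset K^{2^r}.$$ -/

import Mathlib

open NumberField IntermediateField

noncomputable section

namespace KummerCyc

/-- For Dedekind domains `A ⊆ B` and a prime `q` of `A`: the greatest common divisor of the
ramification indices `e(P/q)`, where `P` runs through the primes of `B` above `q`. -/
def ramificationGcd {A : Type*} [CommRing A] (q : Ideal A) (B : Type*) [CommRing B]
    [IsDedekindDomain B] [Algebra A B] : ℕ :=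
  (IsDedekindDomain.primesOverFinset q B).gcd fun P => P.ramificationIdx A

/-- The cyclotomic extension `K(ζ_n)`, as a subfield of the algebraic closure of `K`. -/
def cyclo (K : Type*) [Field K] (n : ℕ) : IntermediateField K (AlgebraicClosure K) :=
  adjoin K {ζ : AlgebraicClosure K | IsPrimitiveRoot ζ n}

theorem exists_sq_eq_neg_one (K : Type*) [Field K] : ∃ z : AlgebraicClosure K, z ^ 2 = -1 :=
  IsAlgClosed.exists_pow_nat_eq (-1) two_pos

/-- A square root `i` of `-1` in the algebraic closure of `K`. -/
def imag (K : Type*) [Field K] : AlgebraicClosure K :=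
  Classical.choose (exists_sq_eq_neg_one K)

theorem imag_sq (K : Type*) [Field K] : imag K ^ 2 = -1 :=
  Classical.choose_spec (exists_sq_eq_neg_one K)

theorem isIntegral_of_sq_eq_neg_one {R : Type*} [CommRing R] {z : R} (h : z ^ 2 = -1) :
    IsIntegral ℤ z :=
  IsIntegral.of_pow two_pos (by rw [h]; exact isIntegral_one.neg)

/-- The field `K(i)`. -/
abbrev Ki (K : Type*) [Field K] : IntermediateField K (AlgebraicClosure K) := K⟮imag K⟯

instance Ki.instFiniteDimensional (K : Type*) [Field K] : FiniteDimensional K (Ki K) :=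
  adjoin.finiteDimensional (Algebra.IsIntegral.isIntegral _)

instance Ki.instNumberField (K : Type*) [Field K] [NumberField K] : NumberField (Ki K) :=
  NumberField.of_module_finite K (Ki K)

/-- The element `i` of `K(i)`. -/
def Ki.i (K : Type*) [Field K] : Ki K := AdjoinSimple.gen K (imag K)

theorem Ki.i_sq (K : Type*) [Field K] : Ki.i K ^ 2 = -1 := by
  apply Subtype.ext
  simpa [Ki.i] using imag_sq K

/-- The field `ℚ(i)`, as a subfield of `K(i)`. -/
abbrev Qi (K : Type*) [Field K] [NumberField K] : IntermediateField ℚ (Ki K) := ℚ⟮Ki.i K⟯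

/-- The element `i` of the ring of integers of `ℚ(i)`. -/
def Qi.i (K : Type*) [Field K] [NumberField K] : 𝓞 (Qi K) :=
  ⟨AdjoinSimple.gen ℚ (Ki.i K), isIntegral_of_sq_eq_neg_one (by
    apply Subtype.ext
    simpa using Ki.i_sq K)⟩

/-- For odd `p`, the number `ε_p` is the gcd of the ramification indices of the primes of `K`
above `p`. The number `ε_2` is the gcd of the ramification indices over `1 + i` of the primes of
`K(i)` above the prime `1 + i` of `ℚ(i)`. -/
def epsilon (K : Type*) [Field K] [NumberField K] (p : ℕ) : ℕ :=
  if p = 2 then ramificationGcd (Ideal.span {1 + Qi.i K}) (𝓞 (Ki K))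
  else ramificationGcd (Ideal.span {(p : ℤ)}) (𝓞 K)

/-- An odd prime `p` is distinguished if `p - 1` divides `ε_p`. -/
def IsDistinguished (K : Type*) [Field K] [NumberField K] (p : ℕ) : Prop :=
  p ≠ 2 ∧ p - 1 ∣ epsilon K p

open Classical in
/-- The exponent `λ_p`. -/
def lam (K : Type*) [Field K] [NumberField K] (p : ℕ) : ℕ :=
  if p = 2 then padicValNat 2 (epsilon K 2) + 3
  else if IsDistinguished K p then padicValNat p (epsilon K p) + 1
  else 0

/-- For an extension `L/K`, the inclusion `L^a ∩ K ⊆ K^b`. -/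
def PowInterSubset (K L : Type*) [Field K] [Field L] [Algebra K L] (a b : ℕ) : Prop :=
  ∀ α : K, (∃ β : L, β ^ a = algebraMap K L α) → ∃ γ : K, γ ^ b = α

end KummerCyc

end

/-! Write `n = p^r m` with `p ∤ m`, let `ω` be a primitive `p^s`-th root of unity (`s = λ + r`, or
`2λ + r` in part 2) and `β^(p^s) = α`. Suppose some `σ` fixes `ζ_m` and `σ ω = ω^X` with `X ≢ 1` mod
`p^(λ+1)`. The cocycle `σ β = ω^c β` is a coboundary (`exists_dvd_sub_mul`), so multiplying `β` by a
power of `ω` gives a `σ`-fixed root `δ`. The extension is abelian: if `τ δ = ω^d δ`, then `σ τ = τ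
σ` gives `(X-1)d ≡ 0` mod `p^s`, so `τ` fixes `δ^(p^λ)`. This element lies in `K`, and its
`p^(s-λ)`-th power is `α` (`exists_pow_eq_of_pow_eq_algebraMap`).

Such a `σ` exists by ramification. Adjoining `ζ_m` is unramified above `p`, so a primitive
`p^(λ+1)`-th root of unity in `F(ζ_m)` would force `p^λ(p-1)` to divide every ramification index of
`F` above `p`, which the choice of `λ` excludes. Here `F = K` for odd `p`, and `F = K(i)` for `p =
2`, where fixing `i` also gives `X ≡ 1` mod 4, as lifting the exponent requires. -/

/-- Lifting the exponent, uniformly in the prime `p`. -/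
theorem emultiplicity_pow_sub_one {p : ℕ} (hp : p.Prime) {X : ℤ} (hX : (p : ℤ) ∣ X - 1)
    (h2 : p = 2 → (4 : ℤ) ∣ X - 1) (o : ℕ) :
    emultiplicity (p : ℤ) (X ^ o - 1) = emultiplicity (p : ℤ) (X - 1) + emultiplicity p o := by
  have hpX : ¬ (p : ℤ) ∣ X := fun h => by
    have h1 : (p : ℤ) ∣ 1 := by simpa using dvd_sub h hX
    exact hp.one_lt.ne' (by exact_mod_cast Int.eq_one_of_dvd_one (by positivity) h1)
  rcases hp.eq_two_or_odd' with rfl | hodd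
  · have := Int.two_pow_sub_pow' (x := X) (y := 1) o (h2 rfl) (by exact_mod_cast hpX)
    rw [one_pow] at this
    rw [← Int.natCast_emultiplicity 2 o]
    exact_mod_cast this
  · have := Int.emultiplicity_pow_sub_pow hp hodd (x := X) (y := 1) hX hpX o
    rwa [one_pow] at this

/-- A cyclic form of the vanishing of the first cohomology of `⟨X⟩ ⊆ (ℤ/p^s)ˣ` with values in
the tautological module `ℤ/p^s`. -/
theorem exists_dvd_sub_mul {p : ℕ} (hp : p.Prime) {s : ℕ} {X c : ℤ}
    (h2 : p = 2 → (4 : ℤ) ∣ X - 1) (hXs : ¬ (p : ℤ) ^ s ∣ X - 1)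
    (hc : ∀ o : ℕ, (p : ℤ) ^ s ∣ X ^ o - 1 →
      (p : ℤ) ^ s ∣ c * ∑ j ∈ Finset.range o, X ^ j) :
    ∃ k : ℤ, (p : ℤ) ^ s ∣ c - (X - 1) * k := by
  have hpZ : Prime (p : ℤ) := Nat.prime_iff_prime_int.mp hp
  have hX0 : X - 1 ≠ 0 := fun h => hXs (by simp [h])
  have hfin : FiniteMultiplicity (p : ℤ) (X - 1) :=
    Int.finiteMultiplicity_iff.mpr ⟨by simpa using hp.one_lt.ne', hX0⟩
  set u := multiplicity (p : ℤ) (X - 1) with hu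
  obtain ⟨w, hw, hpw⟩ := hfin.exists_eq_pow_mul_and_not_dvd
  rw [← hu] at hw
  have hus : u < s := by
    by_contra! h
    exact hXs ((pow_dvd_pow _ h).trans (Dvd.intro _ hw.symm))
  have hcop : IsCoprime w ((p : ℤ) ^ s) :=
    (((Prime.coprime_iff_not_dvd hpZ).mpr hpw).symm).pow_right
  obtain ⟨a, b, hab⟩ := hcop
  -- Since `w` is invertible mod `p^s` with inverse `a`, only the `p`-part of `X - 1` obstructs
  -- solvability.
  suffices h : (p : ℤ) ^ u ∣ c by
    obtain ⟨d, rfl⟩ := h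
    refine ⟨a * d, (p : ℤ) ^ u * d * b, ?_⟩
    rw [hw]
    linear_combination (-(p : ℤ) ^ u * d) * hab
  rcases Nat.eq_zero_or_pos u with h0 | hpos
  · simp [h0]
  have hpX : (p : ℤ) ∣ X - 1 := by
    rw [hw]; exact (dvd_pow_self _ hpos.ne').mul_right _
  -- The exponent `p^(s-u)` gives `X^o - 1` valuation exactly `s`; the geometric sum then has
  -- valuation only `s - u`, leaving `p^u` to divide `c`.
  have hval := emultiplicity_pow_sub_one hp hpX h2 (p ^ (s - u))
  have hpu : emultiplicity p (p ^ (s - u)) = ((s - u : ℕ) : ℕ∞) :=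
    emultiplicity_pow_self_of_prime hp.prime _
  rw [hpu, hfin.emultiplicity_eq_multiplicity, ← hu, ← Nat.cast_add,
    Nat.add_sub_cancel' hus.le] at hval
  have hdvd := hc _ (pow_dvd_of_le_emultiplicity hval.ge)
  have hprod : (p : ℤ) ^ s * (p : ℤ) ^ u ∣ c * (X ^ p ^ (s - u) - 1) := by
    have := mul_dvd_mul hdvd (Dvd.intro _ hw.symm : (p : ℤ) ^ u ∣ X - 1)
    rwa [mul_assoc, geom_sum_mul] at this
  obtain ⟨v, hv, hpv⟩ :=
    (finiteMultiplicity_of_emultiplicity_eq_natCast hval).exists_eq_pow_mul_and_not_dvd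
  rw [multiplicity_eq_of_emultiplicity_eq_some hval] at hv
  rw [hv, mul_left_comm] at hprod
  have := (mul_dvd_mul_iff_left (pow_ne_zero s hpZ.ne_zero)).mp hprod
  exact (((Prime.coprime_iff_not_dvd hpZ).mpr hpv).pow_left).dvd_of_dvd_mul_right this

/-! ### Kummer theory: descending a power from `K(z, ω)` to `K`. -/

section Kummer

variable {K Ω : Type*} [Field K] [Field Ω] [Algebra K Ω]

theorem IsPrimitiveRoot.exists_algEquiv_apply_eq_pow {m : ℕ} [NeZero m] {z : Ω}
    (hz : IsPrimitiveRoot z m) (τ : Ω ≃ₐ[K] Ω) : ∃ a : ℕ, τ z = z ^ a := by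
  obtain ⟨a, -, ha⟩ := hz.eq_pow_of_pow_eq_one (ξ := τ z)
    (by rw [← map_pow, hz.pow_eq_one, map_one])
  exact ⟨a, ha.symm⟩

/-- Automorphisms commute on elements that are determined by the action on roots of unity. -/
theorem algEquiv_apply_comm {m n : ℕ} [NeZero m] [NeZero n] {z ω β : Ω}
    (hz : IsPrimitiveRoot z m) (hω : IsPrimitiveRoot ω n)
    (hβ : ∀ τ : Ω ≃ₐ[K] Ω, τ z = z → τ ω = ω → τ β = β) (σ τ : Ω ≃ₐ[K] Ω) :
    σ (τ β) = τ (σ β) := by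
  have key : ∀ x : Ω, (∃ a, σ x = x ^ a) → (∃ b, τ x = x ^ b) → (τ * σ)⁻¹ (σ (τ x)) = x := by
    rintro x ⟨a, ha⟩ ⟨b, hb⟩
    have : σ (τ x) = (τ * σ) x := by
      rw [AlgEquiv.mul_apply, ha, hb, map_pow, map_pow, ha, hb, ← pow_mul, ← pow_mul, mul_comm]
    rw [this, ← AlgEquiv.mul_apply, inv_mul_cancel, AlgEquiv.one_apply]
  -- The commutator fixes `z` and `ω`, hence `β`.
  have h := hβ ((τ * σ)⁻¹ * (σ * τ))
    (key z (hz.exists_algEquiv_apply_eq_pow σ) (hz.exists_algEquiv_apply_eq_pow τ))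
    (key ω (hω.exists_algEquiv_apply_eq_pow σ) (hω.exists_algEquiv_apply_eq_pow τ))
  have := congrArg (τ * σ) h
  rwa [← AlgEquiv.mul_apply, ← mul_assoc, mul_inv_cancel, one_mul] at this

/-- If `α ∈ K` is a `p^s`-th power of an element `β` of `K(z, ω)`, where `ω` is a primitive
`p^s`-th root of unity, and some automorphism fixes the root of unity `z` and acts on `ω`
nontrivially modulo `p^(l+1)`, then `α` is a `p^(s-l)`-th power in `K`. -/
theorem exists_pow_eq_of_pow_eq_algebraMap [IsGalois K Ω] {p : ℕ} (hp : p.Prime) {s l m X : ℕ}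
    [NeZero m] (hls : l < s) {z ω β : Ω} (hz : IsPrimitiveRoot z m)
    (hω : IsPrimitiveRoot ω (p ^ s))
    (hβ : ∀ τ : Ω ≃ₐ[K] Ω, τ z = z → τ ω = ω → τ β = β)
    {α : K} (hα : β ^ p ^ s = algebraMap K Ω α)
    (σ : Ω ≃ₐ[K] Ω) (hσz : σ z = z) (hσω : σ ω = ω ^ X)
    (h2 : p = 2 → (4 : ℤ) ∣ X - 1) (hXl : ¬ (p : ℤ) ^ (l + 1) ∣ X - 1) :
    ∃ γ : K, γ ^ p ^ (s - l) = α := by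
  have : NeZero p := ⟨hp.ne_zero⟩
  have hω0 : ω ≠ 0 := hω.ne_zero (NeZero.ne _)
  by_cases hβ0 : β = 0
  · refine ⟨0, ?_⟩
    rw [hβ0, zero_pow (NeZero.ne _)] at hα
    rw [zero_pow (NeZero.ne _)]
    exact (map_eq_zero (algebraMap K Ω)).mp hα.symm |>.symm
  have hroot : ∀ (τ : Ω ≃ₐ[K] Ω) (x : Ω), x ≠ 0 → x ^ p ^ s = algebraMap K Ω α →
      ∃ c : ℕ, τ x = ω ^ c * x := by
    intro τ x hx0 hx
    obtain ⟨c, -, hc⟩ := hω.eq_pow_of_pow_eq_one (ξ := τ x / x) (by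
      rw [div_pow, ← map_pow, hx, AlgEquiv.commutes, div_self]
      rw [← hx]; exact pow_ne_zero _ hx0)
    exact ⟨c, by rw [hc, div_mul_cancel₀ _ hx0]⟩
  obtain ⟨c, hc⟩ := hroot σ β hβ0 hα
  have hiterω : ∀ o : ℕ, (σ ^ o) ω = ω ^ X ^ o := by
    intro o
    induction o with
    | zero => simp
    | succ o ih => rw [pow_succ', AlgEquiv.mul_apply, ih, map_pow, hσω, ← pow_mul, pow_succ']
  have hiterz : ∀ o : ℕ, (σ ^ o) z = z := by
    intro o
    induction o with
    | zero => simp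
    | succ o ih => rw [pow_succ', AlgEquiv.mul_apply, ih, hσz]
  have hiterβ : ∀ o : ℕ, (σ ^ o) β = ω ^ (c * ∑ j ∈ Finset.range o, X ^ j) * β := by
    intro o
    induction o with
    | zero => simp
    | succ o ih =>
      rw [pow_succ, AlgEquiv.mul_apply, hc, map_mul, map_pow, hiterω, ih, Finset.sum_range_succ,
        ← mul_assoc, ← pow_mul, ← pow_add]
      ring
  -- The cocycle condition: whenever `σ^o` fixes `ω`, it fixes `β`, so the exponent in `hiterβ`
  -- vanishes mod `p^s`.
  obtain ⟨k, hk⟩ := exists_dvd_sub_mul (c := c) (s := s) hp h2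
    (fun h => hXl ((pow_dvd_pow _ hls).trans h)) (by
      intro o ho
      have hωo : (σ ^ o) ω = ω := by
        rw [hiterω, ← zpow_natCast, ← div_eq_one_iff_eq hω0, div_eq_mul_inv, ← zpow_sub_one₀ hω0,
          hω.zpow_eq_one_iff_dvd]
        exact_mod_cast ho
      have := hβ _ (hiterz o) hωo
      rw [hiterβ, mul_eq_right₀ hβ0, hω.pow_eq_one_iff_dvd] at this
      exact_mod_cast this)
  set δ : Ω := β * ω ^ (-k) with hδ
  have hδ0 : δ ≠ 0 := mul_ne_zero hβ0 (zpow_ne_zero _ hω0)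
  have hδα : δ ^ p ^ s = algebraMap K Ω α := by
    rw [hδ, mul_pow, hα, ← zpow_natCast, ← zpow_mul, mul_comm (-k), zpow_mul, zpow_natCast,
      hω.pow_eq_one, one_zpow, mul_one]
  have hσδ : σ δ = δ := by
    rw [hδ, map_mul, hc, map_zpow₀, hσω, ← zpow_natCast ω c, ← zpow_natCast ω X, ← zpow_mul,
      mul_right_comm, ← zpow_add₀ hω0, mul_comm]
    congr 1
    rw [← div_eq_one_iff_eq (zpow_ne_zero _ hω0), ← zpow_sub₀ hω0, hω.zpow_eq_one_iff_dvd]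
    convert hk using 1
    · push_cast; rfl
    · ring
  have hfix : ∀ τ : Ω ≃ₐ[K] Ω, τ z = z → τ ω = ω → τ δ = δ := by
    intro τ h1 h3
    rw [hδ, map_mul, map_zpow₀, hβ τ h1 h3, h3]
  have hinv : ∀ τ : Ω ≃ₐ[K] Ω, τ (δ ^ p ^ l) = δ ^ p ^ l := by
    intro τ
    obtain ⟨d, hd⟩ := hroot τ δ hδ0 hδα
    have hcomm := algEquiv_apply_comm hz hω hfix σ τ
    rw [hσδ, hd, map_mul, map_pow, hσδ, hσω] at hcomm
    have h1 : ω ^ ((X : ℤ) * d - d) = 1 := by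
      rw [zpow_sub₀ hω0, zpow_mul, zpow_natCast, zpow_natCast, zpow_natCast,
        mul_right_cancel₀ hδ0 hcomm, div_self (pow_ne_zero _ hω0)]
    rw [hω.zpow_eq_one_iff_dvd] at h1
    have hpd : (p : ℤ) ^ s ∣ d * p ^ l := by
      have h1' : (p : ℤ) ^ s ∣ (X - 1) * d := by
        convert h1 using 1
        · push_cast; rfl
        · ring
      have hpZ : Prime (p : ℤ) := Nat.prime_iff_prime_int.mp hp
      have hX0 : (X : ℤ) - 1 ≠ 0 := fun h => hXl (by simp [h])
      obtain ⟨w, hw, hpw⟩ := (Int.finiteMultiplicity_iff.mpr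
        ⟨by simpa using hp.one_lt.ne', hX0⟩ :
        FiniteMultiplicity (p : ℤ) (X - 1)).exists_eq_pow_mul_and_not_dvd
      have hul : multiplicity (p : ℤ) (X - 1) ≤ l := by
        by_contra! h
        exact hXl ((pow_dvd_pow _ h).trans (Dvd.intro _ hw.symm))
      rw [hw, mul_right_comm] at h1'
      have := (((Prime.coprime_iff_not_dvd hpZ).mpr hpw).pow_left).dvd_of_dvd_mul_right h1'
      rw [mul_comm]
      exact this.trans (mul_dvd_mul_right (pow_dvd_pow _ hul) _)
    have hpd' : p ^ s ∣ d * p ^ l := by exact_mod_cast hpd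
    rw [map_pow, hd, mul_pow, ← pow_mul, (hω.pow_eq_one_iff_dvd _).mpr hpd', one_mul]
  obtain ⟨γ, hγ⟩ := (InfiniteGalois.mem_range_algebraMap_iff_fixed (k := K) (δ ^ p ^ l)).mpr hinv
  refine ⟨γ, (algebraMap K Ω).injective ?_⟩
  rw [map_pow, hγ, ← pow_mul, ← pow_add, Nat.add_sub_cancel' hls.le, hδα]

end Kummer

/-! ### Ramification in cyclotomic extensions. -/

section Ramification

open Ideal

/-- In a domain, two distinct `m`-th roots of unity stay distinct modulo a proper ideal
containing an integer prime to `m`. -/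
theorem IsPrimitiveRoot.pow_eq_self_of_sub_mem {R : Type*} [CommRing R] [IsDomain R] {p m : ℕ}
    [NeZero m] (hpm : p.Coprime m) {P : Ideal R} (hP : P ≠ ⊤) (hpP : (p : R) ∈ P) {z : R}
    (hz : IsPrimitiveRoot z m) {a : ℕ} (h : z ^ a - z ∈ P) : z ^ a = z := by
  by_contra hne
  have hm : (m : R) ∈ P := by
    have hu : IsUnit z := hz.isUnit (NeZero.ne m)
    obtain ⟨y, hy⟩ := hu.exists_right_inv
    set η := z ^ a * y with hη
    -- Here `η = z^a / z`. If `η ≠ 1`, its powers up to `m` sum to zero, yet each is `1` mod `P`;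
    -- hence `m ∈ P`.
    have hη1 : η ^ m = 1 := by
      rw [hη, mul_pow, ← pow_mul, mul_comm a, pow_mul, hz.pow_eq_one, one_pow, one_mul,
        ← one_mul (y ^ m)]
      nth_rw 1 [← hz.pow_eq_one]
      rw [← mul_pow, hy, one_pow]
    have hηne : η ≠ 1 := fun h1 => hne (by
      have : η * z = z := by rw [h1, one_mul]
      rwa [hη, mul_assoc, mul_comm y, hy, mul_one] at this)
    have hηP : η - 1 ∈ P := by
      have := P.mul_mem_right y h
      rwa [sub_mul, hy] at this
    have hsum : ∑ j ∈ Finset.range m, η ^ j = 0 := by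
      have := geom_sum_mul η m
      rw [hη1, sub_self] at this
      exact (mul_eq_zero.mp this).resolve_right (sub_ne_zero.mpr hηne)
    have hcast : (m : R) = - ∑ j ∈ Finset.range m, (η ^ j - 1) := by
      rw [Finset.sum_sub_distrib, hsum]; simp
    rw [hcast]
    refine P.neg_mem (P.sum_mem fun j _ => ?_)
    exact P.mem_of_dvd (sub_one_dvd_pow_sub_one η j) hηP
  apply hP
  rw [eq_top_iff_one]
  have := (Nat.isCoprime_iff_coprime.mpr hpm).map (Int.castRingHom R)
  obtain ⟨u, v, huv⟩ := this
  rw [← huv]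
  exact P.add_mem (P.mul_mem_left _ (by simpa using hpP)) (P.mul_mem_left _ (by simpa using hm))

variable {F M : Type*} [Field F] [NumberField F] [Field M] [NumberField M] [Algebra F M]

/-- Adjoining an `m`-th root of unity is unramified at the primes not dividing `m`. -/
theorem ramificationIdx_eq_one_of_isCyclotomicExtension {p m : ℕ} [NeZero m]
    [IsCyclotomicExtension {m} F M] (hpm : p.Coprime m) (Q : Ideal (𝓞 M)) [Q.IsPrime]
    (hpQ : (p : 𝓞 M) ∈ Q) : Q.ramificationIdx (𝓞 F) = 1 := by
  have : IsGalois F M := IsCyclotomicExtension.isGalois {m} F M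
  have hζ := IsCyclotomicExtension.zeta_spec m F M
  have hζi : IsPrimitiveRoot hζ.toInteger m := hζ.toInteger_isPrimitiveRoot
  rw [← ramificationIdxIn_eq_ramificationIdx (Q.under (𝓞 F)) Q Gal(M/F),
    ← card_inertia_eq_ramificationIdxIn (G := Gal(M/F)) (Q.under (𝓞 F)) Q]
  -- Inertia moves `ζ` only within its class mod `Q`, which contains no other power of `ζ`.
  have hbot : Q.inertia Gal(M/F) = ⊥ := by
    rw [eq_bot_iff]
    intro σ hσ
    obtain ⟨a, ha⟩ := hζ.exists_algEquiv_apply_eq_pow σ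
    have hσζ : σ • hζ.toInteger = hζ.toInteger ^ a := by
      apply RingOfIntegers.ext
      exact ha
    have h1 := hσ hζ.toInteger
    rw [hσζ] at h1
    have h2 := hζi.pow_eq_self_of_sub_mem hpm (IsPrime.ne_top ‹_›) hpQ h1
    rw [Subgroup.mem_bot]
    refine AlgEquiv.coe_toAlgHom_injective (hζ.powerBasis F |>.algHom_ext ?_)
    have h3 := congrArg (algebraMap (𝓞 M) M) h2
    simp only [map_pow] at h3
    have h4 : σ (IsCyclotomicExtension.zeta m F M) = IsCyclotomicExtension.zeta m F M :=
      ha.trans h3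
    simpa using h4
  rw [hbot, Subgroup.card_bot]

/-- `p` is totally ramified in `ℚ(ω)`, of degree `p^k(p-1)`, and ramification indices multiply in
towers. -/
theorem dvd_ramificationIdx_of_isPrimitiveRoot {p k : ℕ} [Fact p.Prime] {ω : M}
    (hω : IsPrimitiveRoot ω (p ^ (k + 1))) (Q : Ideal (𝓞 M)) [Q.IsPrime]
    [Q.LiesOver (span {(p : ℤ)})] : p ^ k * (p - 1) ∣ Q.ramificationIdx ℤ := by
  have : NeZero (p ^ (k + 1)) := ⟨pow_ne_zero _ (Fact.out : p.Prime).ne_zero⟩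
  have : IsCyclotomicExtension {p ^ (k + 1)} ℚ ℚ⟮ω⟯ :=
    hω.intermediateField_adjoin_isCyclotomicExtension ℚ
  have : (Q.under (𝓞 ℚ⟮ω⟯)).LiesOver (span {(p : ℤ)}) := LiesOver.tower_bot Q _ _
  rw [← IsCyclotomicExtension.Rat.ramificationIdx_eq_of_prime_pow p k ℚ⟮ω⟯ (Q.under (𝓞 ℚ⟮ω⟯))]
  exact ramificationIdx_below_dvd _ Q

/-- If `F(ζ_m)`, with `p ∤ m`, contains a primitive `p^(k+1)`-th root of unity, then all primes of
`F` above `p` have ramification index divisible by `p^k(p-1)`. -/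
theorem dvd_ramificationIdx_of_isCyclotomicExtension {p k m : ℕ} [Fact p.Prime] [NeZero m]
    [IsCyclotomicExtension {m} F M] (hpm : p.Coprime m) {ω : M}
    (hω : IsPrimitiveRoot ω (p ^ (k + 1))) (P : Ideal (𝓞 F)) [P.IsPrime]
    [P.LiesOver (span {(p : ℤ)})] : p ^ k * (p - 1) ∣ P.ramificationIdx ℤ := by
  obtain ⟨⟨Q, _, _⟩⟩ := P.nonempty_primesOver (S := 𝓞 M)
  have : Q.LiesOver (span {(p : ℤ)}) := LiesOver.trans Q P _
  have hpQ : (p : 𝓞 M) ∈ Q := by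
    have := (mem_of_liesOver Q (span {(p : ℤ)}) (p : ℤ)).mp (mem_span_singleton_self _)
    simpa using this
  have h := dvd_ramificationIdx_of_isPrimitiveRoot hω Q
  rwa [ramificationIdx_tower P Q, ramificationIdx_eq_one_of_isCyclotomicExtension hpm Q hpQ,
    mul_one] at h

end Ramification

/-! ### The numbers `ε_p` and the choice of `λ_p`. -/

namespace KummerCyc

open Ideal UniqueFactorizationMonoid

section Gcd

variable {A B : Type*} [CommRing A] [CommRing B] [IsDedekindDomain B] [Algebra A B]

theorem isPrime_and_map_le_of_mem_primesOverFinset {q : Ideal A} {P : Ideal B}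
    (hP : P ∈ IsDedekindDomain.primesOverFinset q B) :
    P.IsPrime ∧ q.map (algebraMap A B) ≤ P := by
  classical
  have hP' := Multiset.mem_toFinset.mp hP
  exact ⟨isPrime_of_prime (prime_of_factor P hP'), le_of_dvd (dvd_of_mem_factors hP')⟩

/-- An empty gcd would be `0`, and the valuation of `0` bounds nothing; a prime above `q` and
positivity of its index exclude this. -/
theorem ramificationGcd_ne_zero [Module.Finite A B] {q : Ideal A}
    (hbot : q.map (algebraMap A B) ≠ ⊥) (htop : q.map (algebraMap A B) ≠ ⊤) :
    ramificationGcd q B ≠ 0 := by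
  classical
  obtain ⟨P, hP⟩ := exists_mem_factors hbot (by rwa [Ideal.isUnit_iff])
  have hP' : P ∈ IsDedekindDomain.primesOverFinset q B := Multiset.mem_toFinset.mpr hP
  have := (isPrime_and_map_le_of_mem_primesOverFinset hP').1
  exact fun h => (P.ramificationIdx_pos A).ne' (Finset.gcd_eq_zero_iff.mp h P hP')

end Gcd

theorem liesOver_of_natCast_mem {R : Type*} [CommRing R] {p : ℕ} (hp : p.Prime) {P : Ideal R}
    [P.IsPrime] (h : (p : R) ∈ P) : P.LiesOver (span {(p : ℤ)}) := by
  have := Fact.mk hp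
  refine ⟨(Int.ideal_span_isMaximal_of_prime p).eq_of_le IsPrime.ne_top' ?_⟩
  rw [span_singleton_le_iff_mem, mem_comap]
  simpa using h

variable (K : Type*) [Field K] [NumberField K]

theorem exists_isPrime_natCast_mem {p : ℕ} (hp : p.Prime) :
    ∃ P : Ideal (𝓞 K), P.IsPrime ∧ (p : 𝓞 K) ∈ P := by
  have := Fact.mk hp
  have := Int.ideal_span_isMaximal_of_prime p
  obtain ⟨⟨P, h1, h2⟩⟩ := (span {(p : ℤ)}).nonempty_primesOver (S := 𝓞 K)
  have := (mem_of_liesOver P (span {(p : ℤ)}) (p : ℤ)).mp (mem_span_singleton_self _)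
  exact ⟨P, h1, by simpa using this⟩

theorem epsilon_ne_zero_of_ne_two {p : ℕ} (hp : p.Prime) (h2 : p ≠ 2) : epsilon K p ≠ 0 := by
  obtain ⟨P, hP, hpP⟩ := exists_isPrime_natCast_mem K hp
  rw [epsilon, if_neg h2]
  apply ramificationGcd_ne_zero
  · rw [map_span, Set.image_singleton, Ne, span_singleton_eq_bot]
    simpa using hp.ne_zero
  · intro h
    rw [map_span, Set.image_singleton] at h
    refine hP.ne_top (top_le_iff.mp (h ▸ ?_))
    rw [span_singleton_le_iff_mem]
    simpa using hpP

theorem dvd_epsilon_of_ne_two {p d : ℕ} (hp : p.Prime) (h2 : p ≠ 2)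
    (h : ∀ P : Ideal (𝓞 K), P.IsPrime → P.LiesOver (span {(p : ℤ)}) → d ∣ P.ramificationIdx ℤ) :
    d ∣ epsilon K p := by
  rw [epsilon, if_neg h2]
  refine Finset.dvd_gcd fun P hP => ?_
  obtain ⟨hP1, hP2⟩ := isPrime_and_map_le_of_mem_primesOverFinset hP
  rw [map_span, Set.image_singleton, span_singleton_le_iff_mem] at hP2
  exact h P hP1 (liesOver_of_natCast_mem hp (by simpa using hP2))

theorem isPrimitiveRoot_four_of_sq_eq_neg_one {R : Type*} [Field R] [CharZero R] {z : R}
    (h : z ^ 2 = -1) : IsPrimitiveRoot z (2 ^ (1 + 1)) := by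
  have hne : ¬ z ^ 2 ^ 1 = 1 := by
    rw [pow_one, h]; norm_num
  rw [← orderOf_eq_prime_pow hne (by rw [pow_succ, pow_mul, pow_one, h]; norm_num)]
  exact IsPrimitiveRoot.orderOf z

theorem algebraMap_Qi_i_sq : (algebraMap (𝓞 (Qi K)) (𝓞 (Ki K)) (Qi.i K)) ^ 2 = -1 := by
  apply RingOfIntegers.ext
  exact Ki.i_sq K

theorem two_eq_neg_mul_one_add_sq {R : Type*} [CommRing R] {z : R} (h : z ^ 2 = -1) :
    (2 : R) = -z * (1 + z) ^ 2 := by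
  linear_combination (z + 2) * h

/-- `2` is a unit times `(1 + i)^2`. -/
theorem one_add_mem_iff {P : Ideal (𝓞 (Ki K))} [P.IsPrime] :
    1 + algebraMap (𝓞 (Qi K)) (𝓞 (Ki K)) (Qi.i K) ∈ P ↔ (2 : 𝓞 (Ki K)) ∈ P := by
  have h2 := two_eq_neg_mul_one_add_sq (algebraMap_Qi_i_sq K)
  refine ⟨fun h => ?_, fun h => ?_⟩
  · rw [h2]
    exact P.mul_mem_left _ (P.pow_mem_of_mem h 2 two_pos)
  · rw [h2] at h
    refine IsPrime.mem_of_pow_mem ‹_› 2 ((IsPrime.mem_or_mem ‹_› h).resolve_left fun hi => ?_)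
    apply IsPrime.ne_top (I := P) ‹_›
    rw [eq_top_iff_one]
    have := P.mul_mem_left (algebraMap (𝓞 (Qi K)) (𝓞 (Ki K)) (Qi.i K)) hi
    rwa [mul_neg, ← sq, algebraMap_Qi_i_sq, neg_neg] at this

theorem epsilon_two_ne_zero : epsilon K 2 ≠ 0 := by
  obtain ⟨P, hP, hpP⟩ := exists_isPrime_natCast_mem (Ki K) Nat.prime_two
  rw [epsilon, if_pos rfl]
  have hmap : (span {1 + Qi.i K}).map (algebraMap (𝓞 (Qi K)) (𝓞 (Ki K))) =
      span {1 + algebraMap (𝓞 (Qi K)) (𝓞 (Ki K)) (Qi.i K)} := by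
    rw [map_span, Set.image_singleton, map_add, map_one]
  apply ramificationGcd_ne_zero
  · rw [hmap, Ne, span_singleton_eq_bot]
    intro h
    have h2 := two_eq_neg_mul_one_add_sq (algebraMap_Qi_i_sq K)
    rw [h] at h2
    simp at h2
  · intro h
    rw [hmap] at h
    refine hP.ne_top (top_le_iff.mp (h ▸ ?_))
    rw [span_singleton_le_iff_mem, one_add_mem_iff]
    simpa using hpP

/-- The factor 2 is the ramification index of `1 + i` over 2 in `ℚ(i)`. -/
theorem dvd_two_mul_epsilon_two {d : ℕ}
    (h : ∀ P : Ideal (𝓞 (Ki K)), P.IsPrime → P.LiesOver (span {((2 : ℕ) : ℤ)}) →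
      d ∣ P.ramificationIdx ℤ) :
    d ∣ 2 * epsilon K 2 := by
  have : IsCyclotomicExtension {2 ^ (1 + 1)} ℚ (Qi K) :=
    (isPrimitiveRoot_four_of_sq_eq_neg_one (Ki.i_sq K)
      ).intermediateField_adjoin_isCyclotomicExtension ℚ
  have := Fact.mk Nat.prime_two
  rw [epsilon, if_pos rfl, ramificationGcd, ← normalize_eq 2, ← Finset.gcd_mul_left]
  refine Finset.dvd_gcd fun P hP => ?_
  obtain ⟨hP1, hP2⟩ := isPrime_and_map_le_of_mem_primesOverFinset hP
  rw [map_span, Set.image_singleton, span_singleton_le_iff_mem, map_add, map_one,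
    one_add_mem_iff] at hP2
  have hover := liesOver_of_natCast_mem Nat.prime_two (P := P) (by simpa using hP2)
  have : (P.under (𝓞 (Qi K))).LiesOver (span {((2 : ℕ) : ℤ)}) := LiesOver.tower_bot P _ _
  have hd := h P hP1 hover
  rw [ramificationIdx_tower (P.under (𝓞 (Qi K))) P,
    IsCyclotomicExtension.Rat.ramificationIdx_eq_of_prime_pow 2 1 (Qi K)] at hd
  simpa using hd

/-- For a number field `F` inside an extension `Ω`, a primitive `p^(k+1)`-th root of unity in
`F(ζ_m)`, `p ∤ m`, forces ramification of `F` at `p`. -/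
theorem dvd_ramificationIdx_of_mem_adjoin {F Ω : Type*} [Field F] [NumberField F] [Field Ω]
    [Algebra F Ω] [Algebra.IsIntegral F Ω] {p k m : ℕ} (hp : p.Prime)
    [NeZero m] (hpm : p.Coprime m) {z η : Ω}
    (hz : IsPrimitiveRoot z m) (hη : IsPrimitiveRoot η (p ^ (k + 1))) (hmem : η ∈ F⟮z⟯)
    (P : Ideal (𝓞 F)) (hP : P.IsPrime) (hPp : P.LiesOver (span {(p : ℤ)})) :
    p ^ k * (p - 1) ∣ P.ramificationIdx ℤ := by
  have := Fact.mk hp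
  have : IsCyclotomicExtension {m} F F⟮z⟯ := hz.intermediateField_adjoin_isCyclotomicExtension F
  have : FiniteDimensional F F⟮z⟯ := IsCyclotomicExtension.finiteDimensional {m} F _
  have : NumberField F⟮z⟯ := NumberField.of_module_finite F _
  exact dvd_ramificationIdx_of_isCyclotomicExtension (M := F⟮z⟯) hpm (ω := ⟨η, hmem⟩)
    (hη.of_map_of_injective (f := algebraMap F⟮z⟯ Ω) (algebraMap F⟮z⟯ Ω).injective) P

/-- Otherwise `p^λ(p-1) ∣ ε_p`: this makes `p` distinguished, so `λ = ν_p(ε_p) + 1`, and then `p^λ ∣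
ε_p` is absurd. -/
theorem not_mem_adjoin_of_ne_two {Ω : Type*} [Field Ω] [Algebra K Ω]
    [Algebra.IsIntegral K Ω] {p m : ℕ} (hp : p.Prime) (h2 : p ≠ 2) [NeZero m]
    (hpm : p.Coprime m) {z η : Ω} (hz : IsPrimitiveRoot z m)
    (hη : IsPrimitiveRoot η (p ^ (lam K p + 1))) : η ∉ K⟮z⟯ := by
  intro hmem
  have hdvd := dvd_epsilon_of_ne_two K hp h2 (dvd_ramificationIdx_of_mem_adjoin hp hpm hz hη hmem)
  have hdist : IsDistinguished K p := ⟨h2, (dvd_mul_left _ _).trans hdvd⟩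
  have := Fact.mk hp
  have hlam : lam K p = padicValNat p (epsilon K p) + 1 := by rw [lam, if_neg h2, if_pos hdist]
  rw [hlam] at hdvd
  exact pow_succ_padicValNat_not_dvd (epsilon_ne_zero_of_ne_two K hp h2)
    ((dvd_mul_right _ _).trans hdvd)

theorem lam_two : lam K 2 = padicValNat 2 (epsilon K 2) + 3 := if_pos rfl

theorem not_mem_adjoin_two {Ω : Type*} [Field Ω] [Algebra (Ki K) Ω]
    [Algebra.IsIntegral (Ki K) Ω] {m : ℕ} [NeZero m] (hpm : Nat.Coprime 2 m)
    {z η : Ω} (hz : IsPrimitiveRoot z m)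
    (hη : IsPrimitiveRoot η (2 ^ (lam K 2 + 1))) : η ∉ (Ki K)⟮z⟯ := by
  intro hmem
  have hdvd := dvd_two_mul_epsilon_two K
    (dvd_ramificationIdx_of_mem_adjoin Nat.prime_two hpm hz hη hmem)
  have := Fact.mk Nat.prime_two
  rw [lam_two, pow_succ, mul_assoc, mul_comm (2 ^ _), mul_assoc] at hdvd
  -- `2^λ ∣ 2ε_2` even gives `2^(ν+2) ∣ ε_2`, where `ν = ν_2(ε_2)`; one factor 2 is to spare.
  have h3 : 2 ^ (padicValNat 2 (epsilon K 2) + 1) ∣ epsilon K 2 := by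
    refine Dvd.dvd.trans ⟨2, ?_⟩ (Nat.dvd_of_mul_dvd_mul_left two_pos hdvd)
    ring
  exact pow_succ_padicValNat_not_dvd (epsilon_two_ne_zero K) h3

end KummerCyc

/-! ### From ramification to an automorphism, and conclusion. -/

section Assembly

theorem exists_algEquiv_fixing_of_not_mem {F Ω : Type*} [Field F] [Field Ω] [Algebra F Ω]
    [IsGalois F Ω] {z η : Ω} (hη : η ∉ F⟮z⟯) : ∃ σ : Ω ≃ₐ[F] Ω, σ z = z ∧ σ η ≠ η := by
  have h : ¬ ∀ f : Ω ≃ₐ[F⟮z⟯] Ω, f η = η := fun h => hη (by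
    obtain ⟨y, hy⟩ := (InfiniteGalois.mem_range_algebraMap_iff_fixed (k := F⟮z⟯) η).mpr h
    rw [← hy]; exact y.2)
  push Not at h
  obtain ⟨f, hf⟩ := h
  exact ⟨f.restrictScalars F, f.commutes (AdjoinSimple.gen F z), hf⟩

/-- The power of `ω` of order 4 is `±i`, so `σ` fixes it. -/
theorem four_dvd_sub_one_of_fixes_sqrt_neg_one {Ω : Type*} [Field Ω] [CharZero Ω] {s X : ℕ}
    (hs : 2 ≤ s) {ω i : Ω} (hω : IsPrimitiveRoot ω (2 ^ s)) (hi : i ^ 2 = -1) (σ : Ω →+* Ω)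
    (hσi : σ i = i) (hσω : σ ω = ω ^ X) : (4 : ℤ) ∣ X - 1 := by
  set j := ω ^ 2 ^ (s - 2) with hj
  have hj4 : IsPrimitiveRoot j (2 * 2) := hω.pow (by positivity) (by
    rw [show (2 * 2 : ℕ) = 2 ^ 2 by norm_num, ← pow_add, Nat.sub_add_cancel hs])
  have hj2 : j ^ 2 = -1 := (hj4.pow (by norm_num) rfl).eq_neg_one_of_two_right
  have hσj : σ j = j := by
    rcases sq_eq_sq_iff_eq_or_eq_neg.mp (hj2.trans hi.symm) with h | h <;> simp [h, hσi]
  have hj0 : j ≠ 0 := hj4.ne_zero (by norm_num)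
  rw [hj, map_pow, hσω, ← pow_mul, mul_comm, pow_mul, ← hj] at hσj
  have : j ^ ((X : ℤ) - 1) = 1 := by
    rw [zpow_sub_one₀ hj0, zpow_natCast, hσj, mul_inv_cancel₀ hj0]
  exact_mod_cast (hj4.zpow_eq_one_iff_dvd _).mp this

theorem KummerCyc.apply_eq_self_of_mem_cyclo {K : Type*} [Field K] {m n : ℕ} [NeZero m] [NeZero n]
    (hmn : n.Coprime m) {z ω : AlgebraicClosure K} (hz : IsPrimitiveRoot z m)
    (hω : IsPrimitiveRoot ω n) {τ : AlgebraicClosure K ≃ₐ[K] AlgebraicClosure K}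
    (hτz : τ z = z) (hτω : τ ω = ω) {β : AlgebraicClosure K}
    (hβ : β ∈ KummerCyc.cyclo K (n * m)) : τ β = β := by
  have hprod : IsPrimitiveRoot (ω * z) (n * m) := by
    have := IsPrimitiveRoot.orderOf (ω * z)
    rwa [(Commute.all ω z).orderOf_mul_eq_mul_orderOf_of_coprime
      (by rwa [← hω.eq_orderOf, ← hz.eq_orderOf]), ← hω.eq_orderOf, ← hz.eq_orderOf] at this
  induction hβ using adjoin_induction with
  | mem x hx =>
    obtain ⟨a, -, rfl⟩ := hprod.eq_pow_of_pow_eq_one (IsPrimitiveRoot.pow_eq_one hx)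
    rw [map_pow, map_mul, hτz, hτω]
  | algebraMap x => exact τ.commutes x
  | add x y _ _ hx hy => rw [map_add, hx, hy]
  | inv x _ hx => rw [map_inv₀, hx]
  | mul x y _ _ hx hy => rw [map_mul, hx, hy]

/-- If `F(ζ_m)` contains no primitive `p^(l+1)`-th root of unity, then elements of `K` that are
`p^s`-th powers in `K(ζ_(p^s m))` are `p^(s-l)`-th powers in `K`. -/
theorem KummerCyc.powInterSubset_cyclo {K : Type*} [Field K] [CharZero K] (F : Type*) [Field F]
    [Algebra K F] [Algebra F (AlgebraicClosure K)] [IsScalarTower K F (AlgebraicClosure K)]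
    {p s l m : ℕ} (hp : p.Prime) [NeZero m] (hpm : p.Coprime m) (hls : l < s)
    (h2 : p = 2 → 2 ≤ s ∧ ∃ i : F, i ^ 2 = -1)
    (hF : ∀ z η : AlgebraicClosure K, IsPrimitiveRoot z m → IsPrimitiveRoot η (p ^ (l + 1)) →
      η ∉ F⟮z⟯) :
    KummerCyc.PowInterSubset K (KummerCyc.cyclo K (p ^ s * m)) (p ^ s) (p ^ (s - l)) := by
  rintro α ⟨⟨β, hβmem⟩, hβ⟩
  have : NeZero p := ⟨hp.ne_zero⟩
  have : CharZero (AlgebraicClosure K) := algebraRat.charZero _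
  have : IsGalois F (AlgebraicClosure K) := IsGalois.tower_top_of_isGalois K F _
  obtain ⟨z, hz⟩ := HasEnoughRootsOfUnity.exists_primitiveRoot (AlgebraicClosure K) m
  obtain ⟨ω, hω⟩ := HasEnoughRootsOfUnity.exists_primitiveRoot (AlgebraicClosure K) (p ^ s)
  -- Moving this root of unity means exactly `X ≢ 1` mod `p^(l+1)`.
  have hη : IsPrimitiveRoot (ω ^ p ^ (s - (l + 1))) (p ^ (l + 1)) :=
    hω.pow (NeZero.pos _) (by rw [← pow_add, Nat.sub_add_cancel hls])
  obtain ⟨σ, hσz, hση⟩ := exists_algEquiv_fixing_of_not_mem (hF z _ hz hη)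
  obtain ⟨X, hX⟩ := hω.exists_algEquiv_apply_eq_pow σ
  refine exists_pow_eq_of_pow_eq_algebraMap hp hls hz hω (β := β)
    (fun τ h1 h3 => apply_eq_self_of_mem_cyclo (Nat.Coprime.pow_left s hpm) hz hω h1 h3 hβmem)
    (congrArg Subtype.val hβ) (σ.restrictScalars K) hσz hX (fun hp2 => ?_) (fun hdvd => hση ?_)
  · subst hp2
    obtain ⟨hs, i, hi⟩ := h2 rfl
    exact four_dvd_sub_one_of_fixes_sqrt_neg_one hs hω
      (i := algebraMap F (AlgebraicClosure K) i) (by rw [← map_pow, hi, map_neg, map_one])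
      (σ : AlgebraicClosure K →+* AlgebraicClosure K) (σ.commutes i) hX
  · have hω0 : ω ^ p ^ (s - (l + 1)) ≠ 0 := hη.ne_zero (NeZero.ne _)
    have h1 : (ω ^ p ^ (s - (l + 1))) ^ ((X : ℤ) - 1) = 1 :=
      (hη.zpow_eq_one_iff_dvd _).mpr (by exact_mod_cast hdvd)
    rw [zpow_sub_one₀ hω0, zpow_natCast, mul_inv_eq_one₀ hω0] at h1
    rw [map_pow, hX, ← pow_mul, mul_comm, pow_mul, h1]

end Assembly

theorem proposition5p2 (K : Type*) [Field K] [NumberField K] (n p : ℕ) (hn : 0 < n)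
    (hp : p.Prime) (hpn : p ∣ n) :
    ((3 ≤ p ∨ (p = 2 ∧ ∃ i : K, i ^ 2 = -1)) →
      KummerCyc.PowInterSubset K (KummerCyc.cyclo K (n * p ^ KummerCyc.lam K p))
        (p ^ (KummerCyc.lam K p + padicValNat p n)) (p ^ padicValNat p n)) ∧
    ((p = 2 ∧ ¬ ∃ i : K, i ^ 2 = -1) →
      KummerCyc.PowInterSubset K (KummerCyc.cyclo K (n * 4 ^ KummerCyc.lam K 2))
        (2 ^ (2 * KummerCyc.lam K 2 + padicValNat 2 n)) (2 ^ padicValNat 2 n)) := by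
  have := Fact.mk hp
  obtain ⟨m, hnm, hpm⟩ : ∃ m, n = p ^ padicValNat p n * m ∧ p.Coprime m := by
    refine ⟨n / p ^ n.factorization p, ?_, Nat.coprime_ordCompl hp hn.ne'⟩
    rw [← Nat.factorization_def n hp, Nat.ordProj_mul_ordCompl_eq_self]
  have : NeZero m := ⟨by rintro rfl; simp at hnm; lia⟩
  have hr : 1 ≤ padicValNat p n := one_le_padicValNat_of_dvd hn.ne' hpn
  set r := padicValNat p n with hrdef
  clear_value r
  -- Working over `K(i)` serves both parts, as only `σ` must fix `i`; the descent itself is over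
  -- `K`.
  have two : p = 2 → ∀ s, KummerCyc.lam K 2 < s →
      KummerCyc.PowInterSubset K (KummerCyc.cyclo K (2 ^ s * m)) (2 ^ s)
        (2 ^ (s - KummerCyc.lam K 2)) := by
    rintro rfl s hs
    refine KummerCyc.powInterSubset_cyclo (KummerCyc.Ki K) Nat.prime_two hpm hs (fun _ => ⟨?_, ?_⟩)
      fun z η hz hη => KummerCyc.not_mem_adjoin_two K hpm hz hη
    · have := KummerCyc.lam_two K
      lia
    · exact ⟨KummerCyc.Ki.i K, KummerCyc.Ki.i_sq K⟩
  refine ⟨fun h => ?_, ?_⟩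
  · have hN : n * p ^ KummerCyc.lam K p = p ^ (KummerCyc.lam K p + r) * m := by
      rw [hnm]; ring
    rw [hN]
    rcases eq_or_ne p 2 with rfl | hp2
    · simpa using two rfl (KummerCyc.lam K 2 + r) (by lia)
    · have := KummerCyc.powInterSubset_cyclo (K := K) K hp hpm
        (s := KummerCyc.lam K p + r) (l := KummerCyc.lam K p) (by lia) (fun h => absurd h hp2)
        fun z η hz hη => KummerCyc.not_mem_adjoin_of_ne_two K hp hp2 hpm hz hη
      simpa using this
  · rintro ⟨rfl, -⟩ α hα
    rw [← hrdef] at hα ⊢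
    have hN : n * 4 ^ KummerCyc.lam K 2 = 2 ^ (2 * KummerCyc.lam K 2 + r) * m := by
      rw [hnm, pow_add, pow_mul]; ring
    rw [hN] at hα
    obtain ⟨γ, hγ⟩ := two rfl _ (by lia) α hα
    -- The descent yields a `2^(λ+r)`-th root, more than is asked.
    refine ⟨γ ^ 2 ^ KummerCyc.lam K 2, ?_⟩
    rw [← hγ, ← pow_mul, ← pow_add]
    congr 2
    lia
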